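/- Call a topological space $Y$ locally 1-connected if it is locally path connected and locally simply connected, where $Y$ is locally simply connected if for every $y\in Y$ and every open $U\ni y$ there is an open $V$ with $y\in V\subseteq U$ such that every loop in $V$ is nullhomotopic relative to its base point by a homotopy in $U$. Theorem A. Let $X$ be a locally 1-connected metric space, let $n\ge 0$, and let $A_1,\dots,A_n$ be pairwise disjoint (nonempty) subsets of $X$, each of which is connected, locally path connected and compact in the subspace topology. Let $X/(A_1,\dots,A_n)$ be the quotient of $X$ by the equivalence relation $x\sim y \iff x=y$ or $x,y\in A_i$ for some $i$, with the quotient topology. Then $X/(A_1,\dots,A_n)$ is locally 1-connected. -/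

import Mathlib

/-- The equivalence relation on `X` that identifies each member of a pairwise disjoint family of
subsets to a point and identifies nothing else. -/
def collapseSetoid {X ι : Type*} (A : ι → Set X)
    (hA : Pairwise (Function.onFun Disjoint A)) : Setoid X where
  r x y := x = y ∨ ∃ i, x ∈ A i ∧ y ∈ A i
  iseqv :=
    { refl := fun _ => Or.inl rfl
      symm := by
        rintro x y (rfl | ⟨i, hx, hy⟩)
        · exact Or.inl rfl
        · exact Or.inr ⟨i, hy, hx⟩
      trans := by
        rintro x y z (rfl | ⟨i, hx, hy⟩) (rfl | ⟨j, hy', hz⟩)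
        · exact Or.inl rfl
        · exact Or.inr ⟨j, hy', hz⟩
        · exact Or.inr ⟨i, hx, hy⟩
        · have hij : i = j := by
            by_contra hne
            exact Set.disjoint_left.mp (hA hne) hy hy'
          subst hij
          exact Or.inr ⟨i, hx, hz⟩ }

/-- The space `X/(A₁, …, Aₙ)` obtained from `X` by collapsing each member of a pairwise disjoint
family to a point; as a `Quotient` of a topological space it carries the quotient topology. -/
abbrev CollapseSpace {X ι : Type*} (A : ι → Set X)
    (hA : Pairwise (Function.onFun Disjoint A)) : Type _ :=
  Quotient (collapseSetoid A hA)

/-- `V` is simply connected in `U`: every loop in `V` is nullhomotopic, relative to its base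
point, by a homotopy in `U`. -/
def IsSimplyConnectedIn {X : Type*} [TopologicalSpace X] (V U : Set X) : Prop :=
  ∀ (y : X) (γ : Path y y), (∀ t, γ t ∈ V) →
    ∃ H : Path.Homotopy γ (Path.refl y), ∀ p, H p ∈ U

/-- Every open neighbourhood `U` of every point `x` contains an open neighbourhood `V` of `x`
that is simply connected in `U`. -/
def IsLocallySimplyConnected (X : Type*) [TopologicalSpace X] : Prop :=
  ∀ (x : X) (U : Set X), IsOpen U → x ∈ U →
    ∃ V : Set X, IsOpen V ∧ x ∈ V ∧ V ⊆ U ∧ IsSimplyConnectedIn V U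

/-- Locally 1-connected: locally path connected and locally simply connected. -/
def IsLocallyOneConnected (X : Type*) [TopologicalSpace X] : Prop :=
  LocallyPathConnectedSpace X ∧ IsLocallySimplyConnected X

open Set Filter Topology Metric unitInterval

/-! Local path connectedness passes to quotients, and off the `A i` the quotient map is an open
embedding, so only loops near a collapsed point need work. Such a loop lifts to `X` over the open
set `O` of times at which it avoids that point, and the lift approaches `A i` at the boundary of
`O`.

`O` is cut into dyadic intervals on which the lift moves little compared with its distance to `A i`.
`exists_fillings` pushes each piece into `A i` by a small homotopy whose side tracks depend only on
the end points, so neighbouring pieces fit together (`exists_dyadic_glue`). The homotopies shrink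
towards the boundary of `O`, so the constant extension is continuous in the quotient
(`exists_collapse_homotopy`). The result is a free homotopy to a constant loop, made relative to the
base point by `exists_homotopy_refl_of_square`. -/

/-! ### Homotopies with controlled image -/

/-- The loop `p · q⁻¹` is null in `U`; cancelling `q` in the fundamental groupoid of the subspace
`U` keeps the homotopy inside `U`. -/
theorem IsSimplyConnectedIn.exists_homotopy {X : Type*} [TopologicalSpace X] {V U : Set X}
    (h : IsSimplyConnectedIn V U) {x y : X} (p q : Path x y) (hp : ∀ t, p t ∈ V)
    (hq : ∀ t, q t ∈ V) : ∃ H : Path.Homotopy p q, ∀ z, H z ∈ U := by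
  have hVU : V ⊆ U := fun v hv => by
    obtain ⟨H, hH⟩ := h v (Path.refl v) fun _ => hv
    simpa using hH (0, 0)
  have hpq : ∀ t, (p.trans q.symm) t ∈ V := fun t => by
    rw [Path.trans_apply]
    split_ifs
    · exact hp _
    · exact hq _
  obtain ⟨H, hH⟩ := h x (p.trans q.symm) hpq
  have hx : x ∈ U := by simpa using hVU (hp 0)
  have hy : y ∈ U := by simpa using hVU (hp 1)
  let p' : Path (⟨x, hx⟩ : U) ⟨y, hy⟩ :=
    { toFun := fun t => ⟨p t, hVU (hp t)⟩
      continuous_toFun := by fun_prop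
      source' := by simp
      target' := by simp }
  let q' : Path (⟨x, hx⟩ : U) ⟨y, hy⟩ :=
    { toFun := fun t => ⟨q t, hVU (hq t)⟩
      continuous_toFun := by fun_prop
      source' := by simp
      target' := by simp }
  have hnull : (p'.trans q'.symm).Homotopic (Path.refl _) := by
    refine ⟨{ toFun := fun z => ⟨H z, hH z⟩
              continuous_toFun := by fun_prop
              map_zero_left := fun t => ?_
              map_one_left := fun t => ?_
              prop' := fun t s hs => ?_ }⟩
    · refine Subtype.ext ?_
      change H (0, t) = ((p'.trans q'.symm) t : X)
      rw [H.apply_zero]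
      change (p.trans q.symm) t = _
      rw [Path.trans_apply, Path.trans_apply]
      split_ifs <;> rfl
    · refine Subtype.ext ?_
      change H (1, t) = x
      rw [H.apply_one]; rfl
    · refine Subtype.ext ?_
      change H (t, s) = ((p'.trans q'.symm) s : X)
      rcases hs with rfl | rfl
      · simp
      · simp
  have hpq' : p'.Homotopic q' := by
    rw [← Path.Homotopic.Quotient.eq] at hnull ⊢
    rw [Path.Homotopic.Quotient.mk_trans, Path.Homotopic.Quotient.mk_symm,
      Path.Homotopic.Quotient.mk_refl] at hnull
    calc Path.Homotopic.Quotient.mk p'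
        = ((Path.Homotopic.Quotient.mk p').trans (Path.Homotopic.Quotient.mk q').symm).trans
            (Path.Homotopic.Quotient.mk q') := by
          rw [Path.Homotopic.Quotient.trans_assoc, Path.Homotopic.Quotient.symm_trans,
            Path.Homotopic.Quotient.trans_refl]
      _ = Path.Homotopic.Quotient.mk q' := by
          rw [hnull, Path.Homotopic.Quotient.refl_trans]
  obtain ⟨K⟩ := hpq'
  refine ⟨{ toFun := fun z => K z
            continuous_toFun := by fun_prop
            map_zero_left := fun t => ?_
            map_one_left := fun t => ?_
            prop' := fun t s hs => ?_ }, fun z => (K z).2⟩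
  · rw [K.apply_zero]; rfl
  · rw [K.apply_one]; rfl
  · change ((K (t, s) : U) : X) = p s
    rcases hs with rfl | rfl
    · simp
    · simp

/-- The bottom of the square is homotopic to left · top · right⁻¹. Under `G` the two sides agree and
the top is constant, so the image of that path is a track followed by its reverse, and retracts
along the track. -/
theorem exists_homotopy_refl_of_square {Y : Type*} [TopologicalSpace Y] {U : Set Y} {x y : Y}
    (γ : Path x x) (G : C(I × I, Y)) (hbot : ∀ t, G (t, 0) = γ t) (htop : ∀ t, G (t, 1) = y)
    (hside : ∀ u, G (0, u) = G (1, u)) (hU : ∀ z, G z ∈ U) :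
    ∃ H : Path.Homotopy γ (Path.refl x), ∀ z, H z ∈ U := by
  let bot : Path ((0, 0) : I × I) (1, 0) := ⟨⟨fun t => (t, 0), by fun_prop⟩, rfl, rfl⟩
  let top : Path ((0, 1) : I × I) (1, 1) := ⟨⟨fun t => (t, 1), by fun_prop⟩, rfl, rfl⟩
  let left : Path ((0, 0) : I × I) (0, 1) := ⟨⟨fun t => (0, t), by fun_prop⟩, rfl, rfl⟩
  let right : Path ((1, 0) : I × I) (1, 1) := ⟨⟨fun t => (1, t), by fun_prop⟩, rfl, rfl⟩
  let up : Path (0 : I) 1 := ⟨⟨fun t => t, by fun_prop⟩, rfl, rfl⟩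
  have : ContractibleSpace I := (convex_Icc (0 : ℝ) 1).contractibleSpace ⟨0, by simp⟩
  obtain ⟨Φ⟩ := SimplyConnectedSpace.paths_homotopic bot ((left.trans top).trans right.symm)
  obtain ⟨Ψ⟩ := SimplyConnectedSpace.paths_homotopic
    ((up.trans (Path.refl 1)).trans up.symm) (Path.refl 0)
  have h0 : G (0, 0) = x := by rw [hbot, γ.source]
  have h1 : G (1, 0) = x := by rw [hbot, γ.target]
  let M : Path x x := ⟨⟨fun t => G (((left.trans top).trans right.symm) t), by fun_prop⟩,
    by simpa using h0, by simpa using h1⟩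
  have hM : ∀ t, M t = G (0, ((up.trans (Path.refl 1)).trans up.symm) t) := by
    intro t
    change G _ = _
    simp only [Path.trans_apply]
    split_ifs
    · rfl
    · change G (_, 1) = G (0, 1)
      rw [htop, htop]
    · exact (hside _).symm
  let H₁ : Path.Homotopy γ M :=
    { toFun := fun z => G (Φ z)
      continuous_toFun := by fun_prop
      map_zero_left := fun t => by
        rw [Φ.apply_zero]; exact hbot t
      map_one_left := fun t => by
        rw [Φ.apply_one]; rfl
      prop' := by
        rintro t s (rfl | rfl)
        · change G (Φ (t, 0)) = γ 0
          simp [h0]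
        · change G (Φ (t, 1)) = γ 1
          simp [h1] }
  let H₂ : Path.Homotopy M (Path.refl x) :=
    { toFun := fun z => G (0, Ψ z)
      continuous_toFun := by fun_prop
      map_zero_left := fun t => by
        change G (0, Ψ (0, t)) = M t
        rw [Ψ.apply_zero, hM]; rfl
      map_one_left := fun t => by
        change G (0, Ψ (1, t)) = x
        rw [Ψ.apply_one]; exact h0
      prop' := by
        rintro t s (rfl | rfl)
        · change G (0, Ψ (t, 0)) = M 0
          simp [h0]
        · change G (0, Ψ (t, 1)) = M 1
          simp [h0] }
  refine ⟨H₁.trans H₂, fun z => ?_⟩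
  rw [Path.Homotopy.trans_apply]
  split_ifs
  · exact hU _
  · exact hU _

/-! ### Uniformity and simultaneous choice -/

/-- A locally small relation between neighbourhoods is uniformly small near a compact set. -/
theorem IsCompact.exists_uniform_ball {X : Type*} [PseudoMetricSpace X] {K : Set X}
    (hK : IsCompact K) (S : Set X → Set X → Prop)
    (hS : ∀ {V V' U U'}, V' ⊆ V → U ⊆ U' → S V U → S V' U')
    (h : ∀ x ∈ K, ∀ U, IsOpen U → x ∈ U → ∃ V, IsOpen V ∧ x ∈ V ∧ V ⊆ U ∧ S V U)
    {ε : ℝ} (hε : 0 < ε) : ∃ δ, 0 < δ ∧ δ ≤ ε ∧ ∀ a ∈ K, S (ball a δ) (ball a ε) := by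
  have h' := fun x : K => h x x.2 (ball x (ε / 2)) isOpen_ball (mem_ball_self (by positivity))
  choose V hVo hxV hVU hSV using h'
  obtain ⟨δ, hδ, hb⟩ := lebesgue_number_lemma_of_metric hK hVo
    fun x hx => mem_iUnion.2 ⟨⟨x, hx⟩, hxV _⟩
  refine ⟨min δ ε, lt_min hδ hε, min_le_right _ _, fun a ha => ?_⟩
  obtain ⟨x, hx⟩ := hb a ha
  refine hS ((ball_subset_ball (min_le_left _ _)).trans hx) ?_ (hSV x)
  have hax : dist a x < ε / 2 := hVU x (hx (mem_ball_self hδ))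
  refine ball_subset_ball' ?_
  rw [dist_comm] at hax
  linarith

/-- If small indices admit small witnesses, one can choose for each index a witness which is small
whenever the index is. -/
theorem exists_forall_small_choice {ι : Type*} {β : ι → Type*} [∀ i, Nonempty (β i)]
    (size : ι → ℝ) (T : ∀ i, β i → ℝ → Prop)
    (mono : ∀ i b ε ε', ε ≤ ε' → T i b ε → T i b ε')
    (h : ∀ ε > 0, ∃ δ > 0, ∀ i, size i < δ → ∃ b, T i b ε) :
    ∃ b : ∀ i, β i, ∀ ε > 0, ∃ δ > 0, ∀ i, 0 < size i → size i < δ → T i (b i) ε := by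
  let S : ι → Set ℝ := fun i => {ε | 0 < ε ∧ ∃ b, T i b ε}
  -- The infimum need not be attained; the slack `size i` is positive and vanishes with the index,
  -- so one choice serves every `ε`.
  have hb : ∀ i, ∃ b, 0 < size i → (S i).Nonempty → T i b (sInf (S i) + size i) := by
    intro i
    by_cases hi : 0 < size i ∧ (S i).Nonempty
    · obtain ⟨ε, ⟨-, b, hb⟩, hlt⟩ := Real.lt_sInf_add_pos hi.2 hi.1
      exact ⟨b, fun _ _ => mono _ _ _ _ hlt.le hb⟩
    · exact ⟨Classical.arbitrary _, fun h₁ h₂ => (hi ⟨h₁, h₂⟩).elim⟩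
  choose b hb using hb
  refine ⟨b, fun ε hε => ?_⟩
  obtain ⟨δ, hδ, hh⟩ := h (ε / 2) (by positivity)
  refine ⟨min δ (ε / 2), by positivity, fun i hi0 hi => ?_⟩
  have hmem : ε / 2 ∈ S i := ⟨by positivity, hh i (hi.trans_le (min_le_left _ _))⟩
  refine mono _ _ _ _ ?_ (hb i hi0 ⟨_, hmem⟩)
  have h1 : sInf (S i) ≤ ε / 2 := csInf_le ⟨0, fun r hr => hr.1.le⟩ hmem
  have h2 : size i < ε / 2 := hi.trans_le (min_le_right _ _)
  linarith

/-! ### Pushing short paths into `A` -/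

theorem Path.trans_apply_extend {X : Type*} [TopologicalSpace X] {x y z : X} (p : Path x y)
    (q : Path y z) (t : I) :
    (p.trans q) t = if (t : ℝ) ≤ 1 / 2 then p.extend (2 * t) else q.extend (2 * t - 1) :=
  rfl

/-- A path homotopic to `p · α · q⁻¹` can be pushed along `p` and `q` to the path `α`. -/
theorem exists_slide {X : Type*} [TopologicalSpace X] {W B : Set X} {x y a b : X}
    (c : Path x y) (p : Path x a) (q : Path y b) (α : Path a b)
    (H : Path.Homotopy c ((p.trans α).trans q.symm)) (hH : ∀ z, H z ∈ W) (hα : ∀ t, α t ∈ B) :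
    ∃ F : C(I × I, X), (∀ t, F (0, t) = c t) ∧
      (∀ u, F (u, 0) = ((Path.refl x).trans p) u) ∧
      (∀ u, F (u, 1) = ((Path.refl y).trans q) u) ∧
      (∀ t, F (1, t) ∈ B) ∧ ∀ z, F z ∈ W := by
  let Q : Path x y := (p.trans α).trans q.symm
  have hQp : ∀ r : ℝ, r ≤ 1 / 4 → Q.extend r = p.extend (4 * r) := fun r hr => by
    rw [Path.extend_trans_of_le_half _ _ (by linarith),
      Path.extend_trans_of_le_half _ _ (by linarith)]
    ring_nf
  have hQα : ∀ r : ℝ, 1 / 4 ≤ r → r ≤ 1 / 2 → Q.extend r ∈ B := fun r hr hr' => by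
    rw [Path.extend_trans_of_le_half _ _ hr', Path.extend_trans_of_half_le _ _ (by linarith)]
    exact hα _
  have hQq : ∀ r : ℝ, 1 / 2 ≤ r → Q.extend r = q.extend (2 - 2 * r) := fun r hr => by
    rw [Path.extend_trans_of_half_le _ _ hr, Path.extend_symm_apply]
    ring_nf
  have hQW : ∀ r, Q.extend r ∈ W := fun r => by
    have := hH (1, projIcc 0 1 zero_le_one r)
    rwa [H.apply_one] at this
  -- `Q` runs through `p` on `[0, 1/4]`, `α` on `[1/4, 1/2]` and `q⁻¹` on `[1/2, 1]`. At time `s`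
  -- the parameter is clamped to `[s/4, 1 - s/2]`, which ends at the interval of `α` while the end
  -- points follow `p` and `q`.
  let φ : I × I → ℝ := fun z => max ((z.1 : ℝ) / 4) (min (z.2 : ℝ) (1 - (z.1 : ℝ) / 2))
  have hφ : Continuous φ := by fun_prop
  let f₁ : C(I, X) := ⟨fun t => Q.extend (φ (1, t)), by fun_prop⟩
  let H' : ContinuousMap.Homotopy (c : C(I, X)) (Q : C(I, X)) := H.toHomotopy
  let K : ContinuousMap.Homotopy (Q : C(I, X)) f₁ :=
    { toFun := fun z => Q.extend (φ z)
      continuous_toFun := by fun_prop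
      map_zero_left := fun t => by
        have : φ (0, t) = t := by simp [φ, t.2.1, t.2.2]
        rw [this, Path.extend_extends']; rfl
      map_one_left := fun t => rfl }
  have hK : ∀ z, K z = Q.extend (φ z) := fun _ => rfl
  refine ⟨(H'.trans K).toContinuousMap, (H'.trans K).apply_zero, fun u => ?_, fun u => ?_,
    fun t => ?_, fun z => ?_⟩
  · change (H'.trans K) (u, 0) = _
    rw [ContinuousMap.Homotopy.trans_apply, Path.trans_apply_extend]
    split_ifs with hu
    · exact (H.source _).trans (by simp)
    · have h1 := u.2.2
      have e : φ (⟨2 * u - 1, two_mul_sub_one_mem_iff.2 ⟨(not_le.1 hu).le, u.2.2⟩⟩, 0)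
          = (2 * (u : ℝ) - 1) / 4 := by
        have : min ((0 : I) : ℝ) (1 - (2 * (u : ℝ) - 1) / 2) = 0 :=
          min_eq_left (by rw [Icc.coe_zero]; linarith)
        simp only [φ, this]
        exact max_eq_left (by linarith [not_le.1 hu])
      rw [hK, e, hQp _ (by linarith)]
      ring_nf
  · change (H'.trans K) (u, 1) = _
    rw [ContinuousMap.Homotopy.trans_apply, Path.trans_apply_extend]
    split_ifs with hu
    · exact (H.target _).trans (by simp)
    · have h1 := u.2.2
      have h2 := not_le.1 hu
      dsimp only at h2
      have e : φ (⟨2 * u - 1, two_mul_sub_one_mem_iff.2 ⟨(not_le.1 hu).le, u.2.2⟩⟩, 1)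
          = 1 - (2 * (u : ℝ) - 1) / 2 := by
        have : min ((1 : I) : ℝ) (1 - (2 * (u : ℝ) - 1) / 2) = 1 - (2 * (u : ℝ) - 1) / 2 :=
          min_eq_right (by rw [Icc.coe_one]; linarith)
        simp only [φ, this]
        exact max_eq_right (by linarith)
      rw [hK, e, hQq _ (by linarith)]
      ring_nf
  · change (H'.trans K) (1, t) ∈ B
    rw [ContinuousMap.Homotopy.apply_one]
    exact hQα _ (le_max_of_le_left (by norm_num))
      (max_le (by norm_num) ((min_le_right _ _).trans (by norm_num)))
  · change (H'.trans K) z ∈ W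
    rw [ContinuousMap.Homotopy.trans_apply]
    split_ifs
    · exact hH _
    · exact hQW _

/-- Near a compact, locally path connected subset `A` of a locally 1-connected metric space, short
paths can be pushed into `A` by small homotopies, with the tracks `f` of the end points depending
on these end points only. -/
theorem exists_fillings {X : Type*} [MetricSpace X] (hX : IsLocallyOneConnected X) {A : Set X}
    (hA : IsCompact A) (hne : A.Nonempty) (hlpc : LocallyPathConnectedSpace A) :
    ∃ (f : X → I → X) (F : C(I, X) → C(I × I, X)), ∀ ε > 0, ∃ δ > 0, ∀ c : C(I, X),
      0 < infDist (c 0) A → infDist (c 0) A < δ →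
      (∀ t, dist (c t) (c 0) < infDist (c 0) A / 2) →
      (∀ t, F c (0, t) = c t) ∧ (∀ u, F c (u, 0) = f (c 0) u) ∧
      (∀ u, F c (u, 1) = f (c 1) u) ∧ (∀ t, F c (1, t) ∈ A) ∧ ∀ z, dist (F c z) (c 0) < ε := by
  obtain ⟨hX₁, hX₂⟩ := hX
  have hsc : ∀ ε : ℝ, 0 < ε → ∃ δ, 0 < δ ∧ δ ≤ ε ∧
      ∀ a ∈ A, IsSimplyConnectedIn (ball a δ) (ball a ε) := fun ε hε =>
    hA.exists_uniform_ball IsSimplyConnectedIn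
      (fun hV hU h y γ hγ => (h y γ fun t => hV (hγ t)).imp fun H hH p => hU (hH p))
      (fun x _ U hU hx => hX₂ x U hU hx) hε
  have hpc : ∀ ε : ℝ, 0 < ε → ∃ δ, 0 < δ ∧ δ ≤ ε ∧
      ∀ a ∈ A, ∀ x ∈ ball a δ, ∀ y ∈ ball a δ, JoinedIn (ball a ε) x y := fun ε hε =>
    hA.exists_uniform_ball (fun V U => ∀ x ∈ V, ∀ y ∈ V, JoinedIn U x y)
      (fun hV hU h x hx y hy => (h x (hV hx) y (hV hy)).mono hU)
      (fun x _ U hU hx => ⟨pathComponentIn U x, hU.pathComponentIn x, mem_pathComponentIn_self hx,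
        pathComponentIn_subset, fun y hy z hz => hy.symm.trans hz⟩) hε
  have hac : ∀ ε : ℝ, 0 < ε → ∃ δ, 0 < δ ∧ δ ≤ ε ∧
      ∀ a b : A, dist b a < δ → JoinedIn (ball a ε) a b := fun ε hε => by
    have := isCompact_iff_compactSpace.1 hA
    obtain ⟨δ, hδ, hδε, h⟩ := (isCompact_univ (X := A)).exists_uniform_ball
      (fun V U => ∀ x ∈ V, ∀ y ∈ V, JoinedIn U x y)
      (fun hV hU h x hx y hy => (h x (hV hx) y (hV hy)).mono hU)
      (fun x _ U hU hx => ⟨pathComponentIn U x, hU.pathComponentIn x, mem_pathComponentIn_self hx,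
        pathComponentIn_subset, fun y hy z hz => hy.symm.trans hz⟩) hε
    exact ⟨δ, hδ, hδε, fun a b hab => h a trivial a (mem_ball_self hδ) b hab⟩
  have : ∀ x : X, Nonempty (Σ a, Path x a) := fun x => ⟨⟨x, Path.refl x⟩⟩
  obtain ⟨p, hp⟩ := exists_forall_small_choice (fun x => infDist x A)
    (fun x (p : Σ a, Path x a) ε => p.1 ∈ A ∧ ∀ t, dist (p.2 t) x < ε)
    (fun x p ε ε' hε h => ⟨h.1, fun t => (h.2 t).trans_le hε⟩) (fun ε hε => by
      obtain ⟨δ, hδ, hδε, h⟩ := hpc (ε / 2) (by positivity)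
      refine ⟨δ, hδ, fun x hx => ?_⟩
      obtain ⟨a, ha, hxa⟩ := (infDist_lt_iff hne).1 hx
      have hJ := h a ha x hxa a (mem_ball_self hδ)
      refine ⟨⟨a, hJ.somePath⟩, ha, fun t => ?_⟩
      have h₁ : dist (hJ.somePath t) a < ε / 2 := hJ.somePath_mem t
      have h₂ := dist_triangle_right (hJ.somePath t) x a
      dsimp only
      linarith)
  -- The constant first half is the stage of `exists_slide` in which the homotopy fixes the end
  -- points.
  refine ⟨fun x => (Path.refl x).trans (p x).2, ?_⟩
  have : Nonempty C(I × I, X) := ⟨.const _ hne.some⟩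
  obtain ⟨F, hF⟩ := exists_forall_small_choice (fun c : C(I, X) => infDist (c 0) A)
    (fun c (F : C(I × I, X)) ε => 0 < infDist (c 0) A →
      (∀ t, dist (c t) (c 0) < infDist (c 0) A / 2) →
      (∀ t, F (0, t) = c t) ∧ (∀ u, F (u, 0) = ((Path.refl (c 0)).trans (p (c 0)).2) u) ∧
      (∀ u, F (u, 1) = ((Path.refl (c 1)).trans (p (c 1)).2) u) ∧ (∀ t, F (1, t) ∈ A) ∧
      ∀ z, dist (F z) (c 0) < ε)
    (fun c F ε ε' hε h h0 h' => ⟨(h h0 h').1, (h h0 h').2.1, (h h0 h').2.2.1, (h h0 h').2.2.2.1,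
      fun z => ((h h0 h').2.2.2.2 z).trans_le hε⟩) (fun ε hε => by
      -- Loops within `δ₂` of a point of `A` are null within `ε / 2`; points of `A` closer than `δ₃`
      -- are joined in `A` within `δ₂`; tracks starting closer than `δ₄` to `A` stay within `δ₃ / 4`
      -- of their start. The bound `δ₄ / 2` leaves room for `c 1`, whose distance to `A` is below
      -- `3/2` that of `c 0`.
      obtain ⟨δ₂, hδ₂, hδ₂ε, h₂⟩ := hsc (ε / 2) (by positivity)
      obtain ⟨δ₃, hδ₃, hδ₃₂, h₃⟩ := hac δ₂ hδ₂
      obtain ⟨δ₄, hδ₄, h₄⟩ := hp (δ₃ / 4) (by positivity)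
      refine ⟨min (δ₄ / 2) (δ₃ / 4), by positivity, fun c hc => ?_⟩
      by_cases hs : 0 < infDist (c 0) A ∧ ∀ t, dist (c t) (c 0) < infDist (c 0) A / 2
      swap
      · exact ⟨c.comp ⟨Prod.fst, continuous_fst⟩, fun h h' => (hs ⟨h, h'⟩).elim⟩
      obtain ⟨h0, hs⟩ := hs
      have hc4 := hc.trans_le (min_le_left _ _)
      have hc3 := hc.trans_le (min_le_right _ _)
      have hd1 : infDist (c 1) A ≤ infDist (c 0) A + dist (c 1) (c 0) :=
        infDist_le_infDist_add_dist
      have hd0 : infDist (c 0) A ≤ infDist (c 1) A + dist (c 0) (c 1) :=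
        infDist_le_infDist_add_dist
      rw [dist_comm] at hd0
      have hs1 := hs 1
      obtain ⟨ha0, hp0⟩ := h₄ (c 0) h0 (by linarith)
      obtain ⟨ha1, hp1⟩ := h₄ (c 1) (by linarith) (by linarith)
      set a := (p (c 0)).1 with ha
      set b := (p (c 1)).1 with hb
      have hca : dist a (c 0) < δ₃ / 4 := by simpa using hp0 1
      have hcb : dist b (c 1) < δ₃ / 4 := by simpa using hp1 1
      have hba : dist b a < δ₃ := by
        have := dist_triangle4 b (c 1) (c 0) a
        rw [dist_comm (c 0) a] at this
        linarith
      have hJ := h₃ ⟨a, ha0⟩ ⟨b, ha1⟩ hba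
      let α : Path a b := hJ.somePath.map continuous_subtype_val
      have hαb : ∀ t, α t ∈ ball a δ₂ := fun t => hJ.somePath_mem t
      have hαA : ∀ t, α t ∈ A := fun t => (hJ.somePath t).2
      let c' : Path (c 0) (c 1) := ⟨c, rfl, rfl⟩
      have hQ : ∀ t, ((((p (c 0)).2.trans α).trans (p (c 1)).2.symm) t) ∈ ball a δ₂ := by
        intro t
        rw [Path.trans_apply_extend]
        split_ifs
        · change (((p (c 0)).2.trans α) _) ∈ _
          rw [Path.trans_apply_extend]
          split_ifs
          · have := hp0 (projIcc 0 1 zero_le_one (2 * (projIcc 0 1 zero_le_one (2 * (t : ℝ)))))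
            have h' := dist_triangle_right ((p (c 0)).2 (projIcc 0 1 zero_le_one
              (2 * (projIcc 0 1 zero_le_one (2 * (t : ℝ)))))) a (c 0)
            change dist _ _ < _
            exact lt_of_le_of_lt h' (by linarith)
          · exact hαb _
        · have := hp1 (σ (projIcc 0 1 zero_le_one (2 * (t : ℝ) - 1)))
          have h' := dist_triangle4 ((p (c 1)).2 (σ (projIcc 0 1 zero_le_one (2 * (t : ℝ) - 1))))
            (c 1) (c 0) a
          rw [dist_comm (c 0) a] at h'
          change dist _ _ < _
          exact lt_of_le_of_lt h' (by linarith)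
      have hc' : ∀ t, c' t ∈ ball a δ₂ := fun t => by
        have := hs t
        have h' := dist_triangle_right (c t) a (c 0)
        change dist (c t) a < _
        linarith
      obtain ⟨H, hH⟩ := (h₂ a ha0).exists_homotopy c' _ hc' hQ
      obtain ⟨F, hF0, hFl, hFr, hF1, hFW⟩ := exists_slide c' (p (c 0)).2 (p (c 1)).2 α H hH hαA
      refine ⟨F, fun _ _ => ⟨hF0, hFl, hFr, hF1, fun z => ?_⟩⟩
      have h' : dist (F z) a < ε / 2 := hFW z
      have := dist_triangle (F z) a (c 0)
      linarith)
  exact ⟨F, fun ε hε => (hF ε hε).imp fun δ h => ⟨h.1, fun c h0 hc hs => h.2 c h0 hc h0 hs⟩⟩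

/-! ### Gluing over dyadic intervals -/

theorem exists_int_mul_two_pow_of_le {s : ℝ} {m n : ℕ} (hmn : m ≤ n)
    (h : ∃ z : ℤ, s * 2 ^ m = z) : ∃ z : ℤ, s * 2 ^ n = z := by
  obtain ⟨z, hz⟩ := h
  refine ⟨z * 2 ^ (n - m), ?_⟩
  push_cast
  rw [← hz, mul_assoc, ← pow_add, Nat.add_sub_cancel' hmn]

theorem Int.ceil_sub_one_eq_floor {r : ℝ} (h : ¬ ∃ z : ℤ, r = z) : ⌈r⌉ - 1 = ⌊r⌋ := by
  refine (Int.floor_eq_iff.2 ⟨?_, ?_⟩).symm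
  · push_cast
    linarith [Int.ceil_lt_add_one r]
  · push_cast
    have : r ≠ ⌈r⌉ := fun h' => h ⟨_, h'⟩
    linarith [lt_of_le_of_ne (Int.le_ceil r) this]

theorem eventually_floor_eq_nhdsLT (s : ℝ) {a : ℝ} (ha : 0 < a) :
    ∀ᶠ s' in 𝓝[<] s, ⌊s' * a⌋ = ⌈s * a⌉ - 1 := by
  have h : (⌈s * a⌉ - 1 : ℝ) / a < s := by
    rw [div_lt_iff₀ ha]
    linarith [Int.ceil_lt_add_one (s * a)]
  filter_upwards [Ioo_mem_nhdsLT h] with s' hs'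
  rw [Int.floor_eq_iff]
  push_cast
  refine ⟨(div_le_iff₀ ha).1 hs'.1.le, ?_⟩
  have := mul_lt_mul_of_pos_right hs'.2 ha
  linarith [Int.le_ceil (s * a)]

theorem eventually_floor_eq_nhdsGE (s : ℝ) {a : ℝ} (ha : 0 < a) :
    ∀ᶠ s' in 𝓝[≥] s, ⌊s' * a⌋ = ⌊s * a⌋ := by
  have h : s < (⌊s * a⌋ + 1 : ℝ) / a := by
    rw [lt_div_iff₀ ha]
    exact Int.lt_floor_add_one _
  filter_upwards [Ico_mem_nhdsGE h] with s' hs'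
  rw [Int.floor_eq_iff]
  refine ⟨?_, (lt_div_iff₀ ha).1 hs'.2⟩
  exact (Int.floor_le _).trans (mul_le_mul_of_nonneg_right hs'.1 ha.le)

/-- Maps on the strips over the dyadic intervals satisfying `P`, with prescribed restrictions `g`
to the vertical sides, can be glued along the maximal such intervals. -/
theorem exists_dyadic_glue {T Z : Type*} [TopologicalSpace T] [TopologicalSpace Z] {O : Set ℝ}
    {P : ℕ → ℤ → Prop}
    (hP : ∀ s ∈ O, ∃ ε > 0, ∀ (m : ℕ) (k : ℤ), (k : ℝ) ≤ s * 2 ^ m → s * 2 ^ m ≤ k + 1 →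
      1 / (2 : ℝ) ^ m < ε → P m k)
    {K : ℕ → ℤ → ℝ × T → Z} (hK : ∀ m k, P m k → Continuous (K m k)) {g : ℝ → T → Z}
    (hleft : ∀ m k (s : ℝ) u, P m k → s * 2 ^ m = k → K m k (s, u) = g s u)
    (hright : ∀ m k (s : ℝ) u, P m k → s * 2 ^ m = k + 1 → K m k (s, u) = g s u) :
    ∃ m : ℝ → ℕ, (∀ s ∈ O, P (m s) ⌊s * 2 ^ m s⌋) ∧
      ∀ s ∈ O, ∀ u, ContinuousAt (fun z : ℝ × T => K (m z.1) ⌊z.1 * 2 ^ m z.1⌋ z) (s, u) := by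
  classical
  have hpow : ∀ m : ℕ, (0 : ℝ) < 2 ^ m := fun m => by positivity
  have hsmall : ∀ ε : ℝ, 0 < ε → ∃ m : ℕ, 1 / (2 : ℝ) ^ m < ε := fun ε hε => by
    obtain ⟨m, hm⟩ := exists_pow_lt_of_lt_one hε (by norm_num : (1 / 2 : ℝ) < 1)
    exact ⟨m, by rwa [one_div_pow] at hm⟩
  let m : ℝ → ℕ := fun s => if h : ∃ m : ℕ, P m ⌊s * 2 ^ m⌋ then Nat.find h else 0
  have hm_eq : ∀ s n, P n ⌊s * 2 ^ n⌋ → (∀ j < n, ¬ P j ⌊s * 2 ^ j⌋) → m s = n := by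
    intro s n hn hj
    have h : ∃ m : ℕ, P m ⌊s * 2 ^ m⌋ := ⟨n, hn⟩
    simp only [m, dif_pos h]
    exact (Nat.find_eq_iff h).2 ⟨hn, hj⟩
  have hex : ∀ s ∈ O, ∃ m : ℕ, P m ⌊s * 2 ^ m⌋ := fun s hs => by
    obtain ⟨ε, hε, h⟩ := hP s hs
    obtain ⟨m, hm⟩ := hsmall ε hε
    exact ⟨m, h m _ (Int.floor_le _) (Int.lt_floor_add_one _).le hm⟩
  have hm_mem : ∀ s ∈ O, P (m s) ⌊s * 2 ^ m s⌋ := fun s hs => by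
    simp only [m, dif_pos (hex s hs)]
    exact Nat.find_spec (hex s hs)
  have hm_min : ∀ s ∈ O, ∀ j < m s, ¬ P j ⌊s * 2 ^ j⌋ := fun s hs j hj => by
    simp only [m, dif_pos (hex s hs)] at hj
    exact Nat.find_min (hex s hs) hj
  refine ⟨m, hm_mem, fun s hs u => ?_⟩
  have hright_side : ContinuousWithinAt (fun z : ℝ × T => K (m z.1) ⌊z.1 * 2 ^ m z.1⌋ z)
      (Prod.fst ⁻¹' Ici s) (s, u) := by
    refine ((hK _ _ (hm_mem s hs)).continuousWithinAt).congr_of_eventuallyEq ?_ rfl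
    have hev : ∀ᶠ s' in 𝓝[≥] s, ∀ j ∈ Finset.range (m s + 1), ⌊s' * 2 ^ j⌋ = ⌊s * 2 ^ j⌋ :=
      (Finset.eventually_all _).2 fun j _ => eventually_floor_eq_nhdsGE s (hpow j)
    have ht : Tendsto (Prod.fst : ℝ × T → ℝ) (𝓝[Prod.fst ⁻¹' Ici s] (s, u)) (𝓝[≥] s) :=
      continuous_fst.continuousAt.continuousWithinAt.tendsto_nhdsWithin fun _ h => h
    filter_upwards [ht.eventually hev] with z hz
    have e : ⌊z.1 * 2 ^ m s⌋ = ⌊s * 2 ^ m s⌋ := hz _ (by simp)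
    have hmz : m z.1 = m s := hm_eq _ _ (by rw [e]; exact hm_mem s hs) fun j hj => by
      rw [hz j (by simp; omega)]
      exact hm_min s hs j hj
    rw [hmz, e]
  -- From the left, the relevant interval of level `m` is the one containing `s` in its half-open
  -- form `(k, k + 1]`, hence the index `⌈s * 2 ^ m⌉ - 1`.
  have hex' : ∃ m : ℕ, P m (⌈s * 2 ^ m⌉ - 1) := by
    obtain ⟨ε, hε, h⟩ := hP s hs
    obtain ⟨m, hm⟩ := hsmall ε hε
    refine ⟨m, h m _ ?_ ?_ hm⟩
    · push_cast
      linarith [Int.ceil_lt_add_one (s * 2 ^ m)]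
    · push_cast
      linarith [Int.le_ceil (s * 2 ^ m)]
  let n := Nat.find hex'
  have hn : P n (⌈s * 2 ^ n⌉ - 1) := Nat.find_spec hex'
  have hn_min : ∀ j < n, ¬ P j (⌈s * 2 ^ j⌉ - 1) := fun j hj => Nat.find_min hex' hj
  -- If `s` is an end point at level `n`, minimality of `n` makes it one at level `m s` too, and
  -- both values are `g s u`. Otherwise left and right intervals coincide at all levels up to `n`,
  -- so `m s = n`.
  have hval : K (m s) ⌊s * 2 ^ m s⌋ (s, u) = K n (⌈s * 2 ^ n⌉ - 1) (s, u) := by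
    by_cases hint : ∃ z : ℤ, s * 2 ^ n = z
    · have hnm : n ≤ m s ∨ ∃ z : ℤ, s * 2 ^ m s = z := by
        by_contra! hcon
        refine hn_min _ hcon.1 ?_
        rw [Int.ceil_sub_one_eq_floor (by simpa using hcon.2)]
        exact hm_mem s hs
      have hint' : ∃ z : ℤ, s * 2 ^ m s = z :=
        hnm.elim (fun h => exists_int_mul_two_pow_of_le h hint) id
      obtain ⟨z, hz⟩ := hint
      obtain ⟨z', hz'⟩ := hint'
      rw [hleft _ _ s u (hm_mem s hs) (by rw [hz', Int.floor_intCast]),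
        hright _ _ s u hn (by rw [hz, Int.ceil_intCast]; push_cast; ring)]
    · have hfl : ∀ j ≤ n, ⌈s * 2 ^ j⌉ - 1 = ⌊s * 2 ^ j⌋ := fun j hj =>
        Int.ceil_sub_one_eq_floor fun h => hint (exists_int_mul_two_pow_of_le hj h)
      have hmn : m s = n := hm_eq s n (hfl n le_rfl ▸ hn) fun j hj => hfl j hj.le ▸ hn_min j hj
      rw [hmn, hfl n le_rfl]
  have hleft_side : ContinuousWithinAt (fun z : ℝ × T => K (m z.1) ⌊z.1 * 2 ^ m z.1⌋ z)
      (Prod.fst ⁻¹' Iio s) (s, u) := by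
    refine ((hK _ _ hn).continuousWithinAt).congr_of_eventuallyEq ?_ hval
    have hev : ∀ᶠ s' in 𝓝[<] s, ∀ j ∈ Finset.range (n + 1), ⌊s' * 2 ^ j⌋ = ⌈s * 2 ^ j⌉ - 1 :=
      (Finset.eventually_all _).2 fun j _ => eventually_floor_eq_nhdsLT s (hpow j)
    have ht : Tendsto (Prod.fst : ℝ × T → ℝ) (𝓝[Prod.fst ⁻¹' Iio s] (s, u)) (𝓝[<] s) :=
      continuous_fst.continuousAt.continuousWithinAt.tendsto_nhdsWithin fun _ h => h
    filter_upwards [ht.eventually hev] with z hz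
    have e : ⌊z.1 * 2 ^ n⌋ = ⌈s * 2 ^ n⌉ - 1 := hz _ (by simp)
    have hmz : m z.1 = n := hm_eq _ _ (by rw [e]; exact hn) fun j hj => by
      rw [hz j (by simp; omega)]
      exact hn_min j hj
    rw [hmz, e]
  have := hleft_side.union hright_side
  rwa [← preimage_union, Iio_union_Ici, preimage_univ, continuousWithinAt_univ] at this

/-! ### Contracting a family of points near `A` -/

/-- A family of points `c s`, `s ∈ O`, near `A` and tending to `A` at the boundary of `O`, can be
contracted to the point to which `A` is collapsed. -/
theorem exists_collapse_homotopy {X Y : Type*} [MetricSpace X] [TopologicalSpace Y]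
    (hX : IsLocallyOneConnected X) {A : Set X} (hA : IsCompact A) (hne : A.Nonempty)
    (hlpc : LocallyPathConnectedSpace A) {q : X → Y} (hq : Continuous q) {y : Y}
    (hqA : ∀ a ∈ A, q a = y) {R : ℝ} (hR : 0 < R) :
    ∃ δ > 0, ∀ (O : Set ℝ) (c : ℝ → X), IsOpen O → ContinuousOn c O → (∀ s ∈ O, c s ∉ A) →
      (∀ s ∈ O, infDist (c s) A < δ) →
      (∀ s ∉ O, ∀ ρ > 0, ∀ᶠ s' in 𝓝 s, s' ∈ O → infDist (c s') A < ρ) →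
      ∃ H : ℝ × I → Y, Continuous H ∧ (∀ s ∈ O, H (s, 0) = q (c s)) ∧
        (∀ s ∉ O, ∀ u, H (s, u) = y) ∧ (∀ s, H (s, 1) = y) ∧
        (∀ s ∈ O, ∀ u, H (s, u) ∈ q '' thickening R A) ∧
        ∀ (z w : ℤ) (u : I), (z : ℝ) ∈ O → (w : ℝ) ∈ O → c z = c w →
          H ((z : ℝ), u) = H ((w : ℝ), u) := by
  classical
  obtain ⟨f, F, hF⟩ := exists_fillings hX hA hne hlpc
  obtain ⟨δ, hδ, hFδ⟩ := hF (R / 2) (by positivity)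
  refine ⟨min δ (R / 2), by positivity, fun O c hO hc hcA hcδ hlim => ?_⟩
  have hpow : ∀ m : ℕ, (0 : ℝ) < 2 ^ m := fun m => by positivity
  have hpos : ∀ s ∈ O, 0 < infDist (c s) A := fun s hs =>
    (hA.isClosed.notMem_iff_infDist_pos hne).1 (hcA s hs)
  -- Smallness is relative to the distance from `A`, as `exists_fillings` requires; the whole closed
  -- interval must lie in `O`.
  let P : ℕ → ℤ → Prop := fun m k => ∀ s : ℝ, (k : ℝ) ≤ s * 2 ^ m → s * 2 ^ m ≤ k + 1 →
    s ∈ O ∧ dist (c s) (c (k / 2 ^ m)) < infDist (c (k / 2 ^ m)) A / 2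
  have hPleft : ∀ m k, P m k → ((k : ℝ) / 2 ^ m) ∈ O := fun m k h =>
    (h _ (by rw [div_mul_cancel₀ _ (hpow m).ne']) (by
      rw [div_mul_cancel₀ _ (hpow m).ne']; linarith)).1
  have hb : ∀ m k, ∃ b : C(I, X), P m k → ∀ t : I, b t = c ((k + t) / 2 ^ m) := by
    intro m k
    by_cases h : P m k
    · refine ⟨⟨fun t => c ((k + t) / 2 ^ m), ?_⟩, fun _ _ => rfl⟩
      refine hc.comp_continuous (by fun_prop) fun t => ?_
      refine (h _ ?_ ?_).1 <;> rw [div_mul_cancel₀ _ (hpow m).ne'] <;> linarith [t.2.1, t.2.2]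
    · exact ⟨.const _ hne.some, fun h' => (h h').elim⟩
  choose b hb using hb
  have hb0 : ∀ m k, P m k → b m k 0 = c (k / 2 ^ m) := fun m k h => by
    rw [hb m k h]; simp
  have hb1 : ∀ m k, P m k → b m k 1 = c ((k + 1) / 2 ^ m) := fun m k h => by
    rw [hb m k h]; simp
  have hb_pos : ∀ m k, P m k → 0 < infDist (b m k 0) A := fun m k h => by
    rw [hb0 m k h]; exact hpos _ (hPleft m k h)
  have hb_dist : ∀ m k, P m k → ∀ t, dist (b m k t) (b m k 0) < infDist (b m k 0) A / 2 := by
    intro m k h t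
    rw [hb0 m k h, hb m k h]
    refine (h _ ?_ ?_).2 <;> rw [div_mul_cancel₀ _ (hpow m).ne'] <;> linarith [t.2.1, t.2.2]
  have hb_lt : ∀ m k, P m k → infDist (b m k 0) A < min δ (R / 2) := fun m k h => by
    rw [hb0 m k h]; exact hcδ _ (hPleft m k h)
  have hgood := fun m k (h : P m k) =>
    hFδ (b m k) (hb_pos m k h) ((hb_lt m k h).trans_le (min_le_left _ _)) (hb_dist m k h)
  let K : ℕ → ℤ → ℝ × I → Y := fun m k z =>
    q (F (b m k) (z.2, projIcc 0 1 zero_le_one (z.1 * 2 ^ m - k)))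
  have hKc : ∀ m k, P m k → Continuous (K m k) := fun m k _ => by
    have : Continuous fun r : ℝ => projIcc (0 : ℝ) 1 zero_le_one r := continuous_projIcc
    fun_prop
  have hKleft : ∀ m k (s : ℝ) u, P m k → s * 2 ^ m = k → K m k (s, u) = q (f (c s) u) := by
    intro m k s u h hs
    have e : c s = b m k 0 := by rw [hb0 m k h, ← hs, mul_div_cancel_right₀ _ (hpow m).ne']
    simp only [K]
    rw [hs, sub_self, projIcc_left, e, ← (hgood m k h).2.1 u]
    rfl
  have hKright : ∀ m k (s : ℝ) u, P m k → s * 2 ^ m = k + 1 → K m k (s, u) = q (f (c s) u) := by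
    intro m k s u h hs
    have e : c s = b m k 1 := by rw [hb1 m k h, ← hs, mul_div_cancel_right₀ _ (hpow m).ne']
    simp only [K]
    rw [hs, add_sub_cancel_left, projIcc_right, e, ← (hgood m k h).2.2.1 u]
    rfl
  have hP : ∀ s ∈ O, ∃ ε > 0, ∀ (m : ℕ) (k : ℤ), (k : ℝ) ≤ s * 2 ^ m → s * 2 ^ m ≤ k + 1 →
      1 / (2 : ℝ) ^ m < ε → P m k := by
    intro s hs
    have hr := hpos s hs
    -- With `r` the distance at `s`, two nearby points are within `r / 4`, less than half of the at
    -- least `7r / 8` remaining at the left end point.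
    have hnhds : ∀ᶠ s' in 𝓝 s, s' ∈ O ∧ dist (c s') (c s) < infDist (c s) A / 8 :=
      (hO.eventually_mem hs).and ((hc.continuousAt (hO.mem_nhds hs)).eventually
        (ball_mem_nhds _ (by positivity)))
    obtain ⟨ε, hε, hball⟩ := Metric.eventually_nhds_iff.1 hnhds
    refine ⟨ε, hε, fun m k hk hk' hm s' hs' hs'' => ?_⟩
    have hclose : ∀ r : ℝ, (k : ℝ) ≤ r * 2 ^ m → r * 2 ^ m ≤ k + 1 → dist r s < ε := by
      intro r hr hr'
      refine lt_of_le_of_lt ?_ hm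
      have e : |r - s| * 2 ^ m = |r * 2 ^ m - s * 2 ^ m| := by
        rw [← sub_mul, abs_mul, abs_of_pos (hpow m)]
      rw [Real.dist_eq, le_div_iff₀ (hpow m), e, abs_le]
      constructor <;> linarith
    obtain ⟨h₁, h₂⟩ := hball (hclose s' hs' hs'')
    obtain ⟨-, h₃⟩ := hball (hclose (k / 2 ^ m) (by rw [div_mul_cancel₀ _ (hpow m).ne'])
      (by rw [div_mul_cancel₀ _ (hpow m).ne']; linarith))
    refine ⟨h₁, ?_⟩
    have h₄ := dist_triangle_right (c s') (c (k / 2 ^ m)) (c s)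
    have h₅ : infDist (c s) A ≤ infDist (c (k / 2 ^ m)) A + dist (c s) (c (k / 2 ^ m)) :=
      infDist_le_infDist_add_dist
    rw [dist_comm (c s)] at h₅
    linarith
  obtain ⟨m, hm, hmc⟩ := exists_dyadic_glue hP hKc hKleft hKright
  have hzone : ∀ (s : ℝ) (n : ℕ), P n ⌊s * 2 ^ n⌋ →
      ∃ t : I, b n ⌊s * 2 ^ n⌋ t = c s ∧ (t : ℝ) = s * 2 ^ n - ⌊s * 2 ^ n⌋ := by
    intro s n h
    refine ⟨⟨s * 2 ^ n - ⌊s * 2 ^ n⌋, Int.fract_nonneg _, (Int.fract_lt_one _).le⟩, ?_, rfl⟩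
    rw [hb _ _ h]
    congr 1
    simp only [add_sub_cancel]
    rw [mul_div_cancel_right₀ _ (hpow n).ne']
  let H : ℝ × I → Y := fun z => if z.1 ∈ O then K (m z.1) ⌊z.1 * 2 ^ m z.1⌋ z else y
  have hHO : ∀ s ∈ O, ∀ u, H (s, u) = K (m s) ⌊s * 2 ^ m s⌋ (s, u) := fun s hs u => if_pos hs
  have hHn : ∀ s ∉ O, ∀ u, H (s, u) = y := fun s hs u => if_neg hs
  refine ⟨H, ?_, fun s hs => ?_, hHn, fun s => ?_, fun s hs u => ?_, fun z w u hz hw hzw => ?_⟩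
  · refine continuous_iff_continuousAt.2 fun ⟨s, u⟩ => ?_
    by_cases hs : s ∈ O
    · refine (hmc s hs u).congr ?_
      filter_upwards [continuous_fst.continuousAt.preimage_mem_nhds (hO.mem_nhds hs)] with z hz
      exact (if_pos hz).symm
    · rw [ContinuousAt, hHn s hs u]
      refine tendsto_nhds.2 fun W hW hyW => ?_
      obtain ⟨ρ, hρ, hρW⟩ := hA.exists_thickening_subset_open (hW.preimage hq)
        fun a ha => by rw [mem_preimage, hqA a ha]; exact hyW
      -- The left end of an admissible interval is at most twice as far from `A` as any of its
      -- points. Hence the bounds `η / 2` and `ρ / 4` keep the filling inside the `ρ`-thickening.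
      obtain ⟨η, hη, hFη⟩ := hF (ρ / 2) (by positivity)
      have hev := (continuous_fst.tendsto ((s, u) : ℝ × I)).eventually
        (hlim s hs (min (η / 2) (ρ / 4)) (by positivity))
      filter_upwards [hev] with z hz
      rcases z with ⟨s', u'⟩
      by_cases hs' : s' ∈ O
      · rw [mem_preimage, hHO s' hs']
        have hPs := hm s' hs'
        obtain ⟨t, ht, -⟩ := hzone s' _ hPs
        have hd := hb_dist _ _ hPs t
        rw [ht] at hd
        have hi : infDist (b (m s') ⌊s' * 2 ^ m s'⌋ 0) A ≤ infDist (c s') A +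
          dist (b (m s') ⌊s' * 2 ^ m s'⌋ 0) (c s') := infDist_le_infDist_add_dist
        rw [dist_comm] at hi
        have h1 := (hz hs').trans_le (min_le_left _ _)
        have h2 := (hz hs').trans_le (min_le_right _ _)
        dsimp only at h1 h2
        have hFb := (hFη _ (hb_pos _ _ hPs) (by linarith) (hb_dist _ _ hPs)).2.2.2.2
          (u', projIcc 0 1 zero_le_one (s' * 2 ^ m s' - ⌊s' * 2 ^ m s'⌋))
        refine hρW ((mem_thickening_iff_infDist_lt hne).2 ?_)
        refine lt_of_le_of_lt (infDist_le_infDist_add_dist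
          (y := b (m s') ⌊s' * 2 ^ m s'⌋ 0)) ?_
        linarith
      · rw [mem_preimage, hHn s' hs']
        exact hyW
  · rw [hHO s hs]
    obtain ⟨t, ht, ht'⟩ := hzone s _ (hm s hs)
    simp only [K]
    rw [← ht', projIcc_val, (hgood _ _ (hm s hs)).1, ht]
  · by_cases hs : s ∈ O
    · rw [hHO s hs]
      exact hqA _ ((hgood _ _ (hm s hs)).2.2.2.1 _)
    · exact hHn s hs 1
  · rw [hHO s hs]
    refine mem_image_of_mem _ ((mem_thickening_iff_infDist_lt hne).2 ?_)
    have h1 := (hgood _ _ (hm s hs)).2.2.2.2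
      (u, projIcc 0 1 zero_le_one (s * 2 ^ m s - ⌊s * 2 ^ m s⌋))
    have h2 := (hb_lt _ _ (hm s hs)).trans_le (min_le_right _ _)
    refine lt_of_le_of_lt (infDist_le_infDist_add_dist (y := b (m s) ⌊s * 2 ^ m s⌋ 0)) ?_
    linarith
  -- An integer is a left end point at every level, so there `H` follows the track `f`, which
  -- depends only on the point.
  · have hint : ∀ (z : ℤ) (n : ℕ), (z : ℝ) * 2 ^ n = ⌊(z : ℝ) * 2 ^ n⌋ := fun z n => by
      have : (z : ℝ) * 2 ^ n = ((z * 2 ^ n : ℤ) : ℝ) := by push_cast; ring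
      rw [this, Int.floor_intCast]
    rw [hHO _ hz, hHO _ hw, hKleft _ _ _ u (hm _ hz) (hint _ _),
      hKleft _ _ _ u (hm _ hw) (hint _ _), hzw]

/-! ### The collapsed space -/

section Collapse

variable {X ι : Type*} {A : ι → Set X} {hA : Pairwise (Function.onFun Disjoint A)}

theorem collapse_mk_eq_mk {x y : X} :
    Quotient.mk (collapseSetoid A hA) x = Quotient.mk (collapseSetoid A hA) y ↔
      x = y ∨ ∃ i, x ∈ A i ∧ y ∈ A i :=
  Quotient.eq

theorem collapse_out_mk {x : X} (hx : ∀ i, x ∉ A i) :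
    (Quotient.mk (collapseSetoid A hA) x).out = x := by
  rcases collapse_mk_eq_mk.1 (Quotient.out_eq (Quotient.mk (collapseSetoid A hA) x)) with
    h | ⟨i, -, h⟩
  · exact h
  · exact (hx i h).elim

variable [TopologicalSpace X]

theorem collapse_isOpen_image {W : Set X} (hW : IsOpen W)
    (hsat : ∀ i, ∀ x ∈ A i, ∀ y ∈ A i, x ∈ W → y ∈ W) :
    IsOpen (Quotient.mk (collapseSetoid A hA) '' W) := by
  rw [← isQuotientMap_quotient_mk'.isOpen_preimage]
  convert hW using 1
  refine Subset.antisymm ?_ (subset_preimage_image _ _)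
  rintro y ⟨x, hx, hxy⟩
  rcases collapse_mk_eq_mk.1 hxy with rfl | ⟨i, hxi, hyi⟩
  · exact hx
  · exact hsat i x hxi y hyi hx

/-- On the open complement of the `A i` the quotient map is injective and open, and `Quotient.out`
is its inverse. -/
theorem collapse_continuousOn_out (hclosed : IsClosed (⋃ i, A i)) :
    ContinuousOn (Quotient.out : CollapseSpace A hA → X)
      (Quotient.mk (collapseSetoid A hA) '' (⋃ i, A i)ᶜ) := by
  rintro _ ⟨x, hx, rfl⟩
  refine ContinuousAt.continuousWithinAt ?_
  have hx' : ∀ i, x ∉ A i := by simpa using hx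
  rw [ContinuousAt, collapse_out_mk hx']
  refine tendsto_nhds.2 fun W hW hxW => ?_
  have hopen : IsOpen (Quotient.mk (collapseSetoid A hA) '' (W ∩ (⋃ i, A i)ᶜ)) :=
    collapse_isOpen_image (hW.inter hclosed.isOpen_compl) fun i z hz _ _ h =>
      (h.2 (mem_iUnion_of_mem i hz)).elim
  refine mem_of_superset (hopen.mem_nhds ⟨x, ⟨hxW, hx⟩, rfl⟩) ?_
  rintro _ ⟨z, hz, rfl⟩
  rw [mem_preimage, collapse_out_mk (by simpa using hz.2)]
  exact hz.1

theorem collapse_exists_isSimplyConnectedIn_of_notMem (hX : IsLocallySimplyConnected X)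
    (hclosed : IsClosed (⋃ i, A i)) {x : X} (hx : x ∉ ⋃ i, A i) {U : Set (CollapseSpace A hA)}
    (hU : IsOpen U) (hxU : Quotient.mk _ x ∈ U) :
    ∃ V : Set (CollapseSpace A hA), IsOpen V ∧ Quotient.mk _ x ∈ V ∧ V ⊆ U ∧
      IsSimplyConnectedIn V U := by
  have hq : Continuous (Quotient.mk (collapseSetoid A hA)) := continuous_quotient_mk'
  obtain ⟨V, hV, hxV, hVU, hsc⟩ := hX x (Quotient.mk _ ⁻¹' U ∩ (⋃ i, A i)ᶜ)
    ((hU.preimage hq).inter hclosed.isOpen_compl) ⟨hxU, hx⟩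
  refine ⟨Quotient.mk _ '' V, collapse_isOpen_image hV fun i z hz _ _ h =>
    ((hVU h).2 (mem_iUnion_of_mem i hz)).elim, mem_image_of_mem _ hxV, ?_, fun y γ hγ => ?_⟩
  · rintro _ ⟨z, hz, rfl⟩
    exact (hVU hz).1
  · let γ' : Path y.out y.out :=
      { toFun := fun t => (γ t).out
        continuous_toFun := (collapse_continuousOn_out hclosed).comp_continuous γ.continuous
          fun t => image_mono (fun z hz => (hVU hz).2) (hγ t)
        source' := by simp
        target' := by simp }
    obtain ⟨H, hH⟩ := hsc _ γ' fun t => by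
      obtain ⟨z, hz, hzt⟩ := hγ t
      change (γ t).out ∈ V
      rw [← hzt, collapse_out_mk (by simpa using (hVU hz).2)]
      exact hz
    refine ⟨{ toFun := fun p => Quotient.mk _ (H p)
              continuous_toFun := hq.comp H.continuous
              map_zero_left := fun t => ?_
              map_one_left := fun t => ?_
              prop' := ?_ }, fun p => (hH p).1⟩
    · rw [H.apply_zero]
      exact Quotient.out_eq _
    · rw [H.apply_one]
      exact Quotient.out_eq _
    · rintro t s (rfl | rfl)
      · change Quotient.mk _ (H (t, 0)) = γ 0
        rw [H.source, Quotient.out_eq, γ.source]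
      · change Quotient.mk _ (H (t, 1)) = γ 1
        rw [H.target, Quotient.out_eq, γ.target]

end Collapse

theorem collapse_exists_isSimplyConnectedIn_of_mem {X ι : Type*} [MetricSpace X] [Finite ι]
    (hX : IsLocallyOneConnected X) {A : ι → Set X} {hA : Pairwise (Function.onFun Disjoint A)}
    (hcomp : ∀ i, IsCompact (A i)) {i : ι} (hlpc : LocallyPathConnectedSpace (A i)) {x : X}
    (hx : x ∈ A i) {U : Set (CollapseSpace A hA)} (hU : IsOpen U) (hxU : Quotient.mk _ x ∈ U) :
    ∃ V : Set (CollapseSpace A hA), IsOpen V ∧ Quotient.mk _ x ∈ V ∧ V ⊆ U ∧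
      IsSimplyConnectedIn V U := by
  have hq : Continuous (Quotient.mk (collapseSetoid A hA)) := continuous_quotient_mk'
  have hclosed : IsClosed (⋃ j, A j) := isClosed_iUnion_of_finite fun j => (hcomp j).isClosed
  have hne : (A i).Nonempty := ⟨x, hx⟩
  have hqA : ∀ a ∈ A i, Quotient.mk (collapseSetoid A hA) a = Quotient.mk _ x := fun a ha =>
    collapse_mk_eq_mk.2 (Or.inr ⟨i, ha, hx⟩)
  -- Staying away from the other `A j` makes thickenings of `A i` saturated, so their images are
  -- open.
  have hCc : IsClosed (⋃ j : {j // j ≠ i}, A j) :=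
    isClosed_iUnion_of_finite fun j => (hcomp j).isClosed
  obtain ⟨R, hR, hRU⟩ := (hcomp i).exists_thickening_subset_open
    ((hU.preimage hq).inter hCc.isOpen_compl) fun a ha => ⟨by
      rw [mem_preimage, hqA a ha]; exact hxU, fun h => by
        obtain ⟨j, hj⟩ := mem_iUnion.1 h
        exact disjoint_left.1 (hA j.2) hj ha⟩
  have hdisj : ∀ z ∈ thickening R (A i), ∀ j, z ∈ A j → j = i := fun z hz j hj => by
    by_contra hji
    exact (hRU hz).2 (mem_iUnion.2 ⟨⟨j, hji⟩, hj⟩)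
  have hopen : ∀ r, 0 < r → r ≤ R →
      IsOpen (Quotient.mk (collapseSetoid A hA) '' thickening r (A i)) := fun r hr hrR =>
    collapse_isOpen_image isOpen_thickening fun j a ha b hb har => by
      obtain rfl := hdisj a (thickening_mono hrR _ har) j ha
      exact self_subset_thickening hr _ hb
  have hout : ∀ r ≤ R, ∀ w ∈ Quotient.mk (collapseSetoid A hA) '' thickening r (A i),
      w ≠ Quotient.mk _ x → w.out ∈ thickening r (A i) ∧ ∀ j, w.out ∉ A j := by
    rintro r hr _ ⟨z, hz, rfl⟩ hzx
    have hz' : ∀ j, z ∉ A j := fun j hj => by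
      obtain rfl := hdisj z (thickening_mono hr _ hz) j hj
      exact hzx (hqA z hj)
    rw [collapse_out_mk hz']
    exact ⟨hz, hz'⟩
  obtain ⟨δ, hδ, hcol⟩ := exists_collapse_homotopy hX (hcomp i) hne hlpc hq hqA hR
  refine ⟨Quotient.mk _ '' thickening (min δ R) (A i), hopen _ (by positivity) (min_le_right _ _),
    mem_image_of_mem _ (self_subset_thickening (by positivity) _ hx), ?_, fun y γ hγ => ?_⟩
  · rintro _ ⟨z, hz, rfl⟩
    exact (hRU (thickening_mono (min_le_right _ _) _ hz)).1
  have hpt : IsClosed ({Quotient.mk _ x} : Set (CollapseSpace A hA)) := by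
    rw [← isQuotientMap_quotient_mk'.isClosed_preimage]
    convert (hcomp i).isClosed using 1
    ext z
    refine ⟨fun hz => ?_, fun hz => hqA z hz⟩
    rcases collapse_mk_eq_mk.1 (mem_singleton_iff.1 hz) with rfl | ⟨j, hzj, hxj⟩
    · exact hx
    · obtain rfl := hdisj x (self_subset_thickening hR _ hx) j hxj
      exact hzj
  have hmem : ∀ s, γ.extend s ≠ Quotient.mk _ x →
      (γ.extend s).out ∈ thickening (min δ R) (A i) ∧ ∀ j, (γ.extend s).out ∉ A j := fun s hs =>
    hout _ (min_le_right _ _) _ (hγ _) hs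
  -- The loop is extended to `ℝ` by constants, so `0` and `1` become integer parameters with the
  -- same lift, and the sides of the square agree.
  obtain ⟨H, hHc, hH0, hHn, hH1, hHU, hHs⟩ := hcol {s | γ.extend s ≠ Quotient.mk _ x}
    (fun s => (γ.extend s).out) (hpt.isOpen_compl.preimage γ.continuous_extend)
    ((collapse_continuousOn_out hclosed).comp γ.continuous_extend.continuousOn fun s hs =>
      ⟨_, by simpa using (hmem s hs).2, Quotient.out_eq _⟩)
    (fun s hs => (hmem s hs).2 i)
    (fun s hs => ((mem_thickening_iff_infDist_lt hne).1 (hmem s hs).1).trans_le (min_le_left _ _))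
    (fun s hs ρ hρ => by
      have hsx : γ.extend s = Quotient.mk _ x := not_not.1 hs
      have hnhds := (hopen (min ρ R) (by positivity) (min_le_right _ _)).mem_nhds
        (mem_image_of_mem _ (self_subset_thickening (by positivity) _ hx))
      rw [← hsx] at hnhds
      filter_upwards [γ.continuous_extend.continuousAt.preimage_mem_nhds hnhds] with s' hs' hne'
      exact ((mem_thickening_iff_infDist_lt hne).1
        (hout _ (min_le_right _ _) _ hs' hne').1).trans_le (min_le_left _ _))
  refine exists_homotopy_refl_of_square γ ⟨fun z : I × I => H ((z.1 : ℝ), z.2), by fun_prop⟩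
    (y := Quotient.mk _ x) (fun t => ?_) (fun t => hH1 _) (fun u => ?_) (fun z => ?_)
  · change H ((t : ℝ), 0) = γ t
    by_cases ht : γ.extend t = Quotient.mk _ x
    · rw [hHn _ (not_not.2 ht), ← ht, Path.extend_extends']
    · rw [hH0 _ ht, Quotient.out_eq, Path.extend_extends']
  · change H (((0 : I) : ℝ), u) = H (((1 : I) : ℝ), u)
    rw [Icc.coe_zero, Icc.coe_one]
    by_cases hy : y = Quotient.mk _ x
    · rw [hHn, hHn]
      · simpa using hy
      · simpa using hy
    · simpa using hHs 0 1 u (by simpa using hy) (by simpa using hy) (by simp)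
  · change H ((z.1 : ℝ), z.2) ∈ U
    by_cases ht : γ.extend z.1 = Quotient.mk _ x
    · rw [hHn _ (not_not.2 ht)]
      exact hxU
    · obtain ⟨w, hw, hwz⟩ := hHU _ ht z.2
      rw [← hwz]
      exact (hRU hw).1

theorem theoremA {X : Type*} [MetricSpace X] (hX : IsLocallyOneConnected X)
    (n : ℕ) (A : Fin n → Set X)
    (hdisj : Pairwise (Function.onFun Disjoint A))
    (hconn : ∀ i, IsConnected (A i))
    (hlpc : ∀ i, LocallyPathConnectedSpace (A i))
    (hcomp : ∀ i, IsCompact (A i)) :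
    IsLocallyOneConnected (CollapseSpace A hdisj) := by
  have := hX.1
  refine ⟨inferInstance, fun y U hU hyU => ?_⟩
  induction y using Quotient.ind with | _ x => ?_
  by_cases hx : x ∈ ⋃ i, A i
  · obtain ⟨i, hi⟩ := mem_iUnion.1 hx
    exact collapse_exists_isSimplyConnectedIn_of_mem hX hcomp (hlpc i) hi hU hyU
  · exact collapse_exists_isSimplyConnectedIn_of_notMem hX.2
      (isClosed_iUnion_of_finite fun j => (hcomp j).isClosed) hx hU hyU
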